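/- Let $\mathbb F$ be a field of characteristic $0$, let $m\ge 1$, let $V$ be a $2m$-dimensional vector space over $\mathbb F$ with a non-degenerate skew-symmetric bilinear form $\omega$, and let $\mathfrak h_m=V\oplus\mathbb F\hbar$ be the Heisenberg Lie algebra, with bracket $[u+a\hbar,v+b\hbar]=\omega(u,v)\hbar$ for $u,v\in V$ and $a,b\in\mathbb F$. If $\phi:\mathfrak h_m\to\mathfrak h_m$ is a linear map such that $\phi(\hbar)=0$, $\phi(V)\subseteq V$, $\phi|_V$ is invertible and $\omega(\phi(u),v)=-\omega(u,\phi(v))$ for all $u,v\in V$, then $\phi$ is a derivation of $\mathfrak h_m$, and the Heisenberg Lie algebra extended by $\phi$ is the Lie algebra $\mathfrak h_m(\phi)=\mathbb F\phi\oplus\mathfrak h_m$ whose bracket extends that of $\mathfrak h_m$ by $[\phi,x]=\phi(x)$ for $x\in\mathfrak h_m$. Let $\mathfrak g$ be a finite-dimensional Lie algebra over $\mathbb F$ with an invariant metric $B$, that is, a non-degenerate symmetric bilinear form with $B(x,[y,z])=B([x,y],z)$ for all $x,y,z\in\mathfrak g$. Suppose that the nilradical $\operatorname{Nil}(\mathfrak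 g)$ (the largest nilpotent ideal of $\mathfrak g$) is isomorphic, as a Lie algebra, to $\mathfrak h_m$. Then: (i) the solvable radical $\operatorname{Rad}(\mathfrak g)$ is isomorphic, as a Lie algebra, to $\mathfrak h_m(\phi)$ for some linear map $\phi$ as above; (ii) $\operatorname{Rad}(\mathfrak g)$ is a non-degenerate ideal of $\mathfrak g$, i.e. the restriction of $B$ to $\operatorname{Rad}(\mathfrak g)\times\operatorname{Rad}(\mathfrak g)$ is non-degenerate. -/

import Mathlib

/-- An invariant metric on a Lie algebra: a non-degenerate symmetric bilinear form `B` with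
`B(x, [y, z]) = B([x, y], z)`. A Lie algebra is quadratic if it carries such a form. -/
structure IsInvariantMetric {F g : Type*} [Field F] [LieRing g] [LieAlgebra F g]
    (B : LinearMap.BilinForm F g) : Prop where
  nondegenerate : B.Nondegenerate
  symm : ∀ x y : g, B x y = B y x
  invariant : ∀ x y z : g, B x ⁅y, z⁆ = B ⁅x, y⁆ z

/-- The nilradical: the sum of all ideals that are nilpotent as Lie algebras (in finite dimension
this is the largest nilpotent ideal).

Mathlib's `LieAlgebra.maxNilpotentIdeal` is a different object: it is the largest ideal on which
the whole of `g` acts nilpotently. -/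
def nilpotentRadical (F g : Type*) [Field F] [LieRing g] [LieAlgebra F g] : LieIdeal F g :=
  sSup {I : LieIdeal F g | LieRing.IsNilpotent I}

/-- The underlying set `V ⊕ F ħ` of the Heisenberg Lie algebra of a bilinear form `ω` on `V`;
the pair `(v, c)` stands for `v + c ħ`. -/
@[ext] structure HeisenbergAlgebra {F V : Type*} [Field F] [AddCommGroup V] [Module F V]
    (ω : LinearMap.BilinForm F V) (hω : ω.IsAlt) where
  vec : V
  coeff : F

namespace HeisenbergAlgebra

variable {F V : Type*} [Field F] [AddCommGroup V] [Module F V]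
  {ω : LinearMap.BilinForm F V} {hω : ω.IsAlt}

def toProd : HeisenbergAlgebra ω hω ≃ V × F where
  toFun x := (x.vec, x.coeff)
  invFun p := ⟨p.1, p.2⟩
  left_inv _ := rfl
  right_inv _ := rfl

instance : AddCommGroup (HeisenbergAlgebra ω hω) := toProd.addCommGroup

instance : Module F (HeisenbergAlgebra ω hω) := toProd.module F

@[simp] lemma zero_vec : (0 : HeisenbergAlgebra ω hω).vec = 0 := rfl
@[simp] lemma zero_coeff : (0 : HeisenbergAlgebra ω hω).coeff = 0 := rfl
@[simp] lemma add_vec (x y : HeisenbergAlgebra ω hω) : (x + y).vec = x.vec + y.vec := rfl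
@[simp] lemma add_coeff (x y : HeisenbergAlgebra ω hω) :
    (x + y).coeff = x.coeff + y.coeff := rfl
@[simp] lemma sub_vec (x y : HeisenbergAlgebra ω hω) : (x - y).vec = x.vec - y.vec := rfl
@[simp] lemma sub_coeff (x y : HeisenbergAlgebra ω hω) :
    (x - y).coeff = x.coeff - y.coeff := rfl
@[simp] lemma smul_vec (t : F) (x : HeisenbergAlgebra ω hω) : (t • x).vec = t • x.vec := rfl
@[simp] lemma smul_coeff (t : F) (x : HeisenbergAlgebra ω hω) :
    (t • x).coeff = t * x.coeff := rfl

/-- The Heisenberg bracket `[u + a ħ, v + b ħ] = ω(u, v) ħ`. -/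
instance : Bracket (HeisenbergAlgebra ω hω) (HeisenbergAlgebra ω hω) where
  bracket x y := ⟨0, ω x.vec y.vec⟩

@[simp] lemma lie_vec (x y : HeisenbergAlgebra ω hω) : ⁅x, y⁆.vec = 0 := rfl
@[simp] lemma lie_coeff (x y : HeisenbergAlgebra ω hω) : ⁅x, y⁆.coeff = ω x.vec y.vec := rfl

instance : LieRing (HeisenbergAlgebra ω hω) where
  add_lie x y z := by ext <;> simp
  lie_add x y z := by ext <;> simp
  lie_self x := by ext <;> simp [hω x.vec]
  leibniz_lie x y z := by ext <;> simp

instance : LieAlgebra F (HeisenbergAlgebra ω hω) where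
  lie_smul t x y := by ext <;> simp

variable (ω hω) in
/-- The central element `ħ`. -/
def hbar : HeisenbergAlgebra ω hω := ⟨0, 1⟩

variable (ω hω) in
/-- The inclusion `V → V ⊕ F ħ`. -/
def ofVec (v : V) : HeisenbergAlgebra ω hω := ⟨v, 0⟩

/-- The linear maps `φ` of the Heisenberg Lie algebra by which it is extended:
`φ(ħ) = 0`, `φ(V) ⊆ V`, `φ|_V` is invertible, and `φ|_V` is skew-symmetric with respect to `ω`. -/
structure IsExtending (φ : HeisenbergAlgebra ω hω →ₗ[F] HeisenbergAlgebra ω hω) : Prop where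
  map_hbar : φ (hbar ω hω) = 0
  map_vec : ∀ v : V, (φ (ofVec ω hω v)).coeff = 0
  bijective : Function.Bijective (fun v : V => (φ (ofVec ω hω v)).vec)
  skew : ∀ u v : V, ω (φ (ofVec ω hω u)).vec v = -ω u (φ (ofVec ω hω v)).vec

lemma eq_ofVec_add_smul_hbar (x : HeisenbergAlgebra ω hω) :
    x = ofVec ω hω x.vec + x.coeff • hbar ω hω := by
  ext <;> simp [ofVec, hbar]

lemma IsExtending.apply_eq {φ : HeisenbergAlgebra ω hω →ₗ[F] HeisenbergAlgebra ω hω}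
    (hφ : IsExtending φ) (x : HeisenbergAlgebra ω hω) : φ x = φ (ofVec ω hω x.vec) := by
  conv_lhs => rw [eq_ofVec_add_smul_hbar x]
  simp [hφ.map_hbar]

/-- Such a linear map is a derivation of the Heisenberg Lie algebra. -/
lemma IsExtending.map_lie {φ : HeisenbergAlgebra ω hω →ₗ[F] HeisenbergAlgebra ω hω}
    (hφ : IsExtending φ) (x y : HeisenbergAlgebra ω hω) : φ ⁅x, y⁆ = ⁅φ x, y⁆ + ⁅x, φ y⁆ := by
  have h0 : φ ⁅x, y⁆ = 0 := by
    rw [hφ.apply_eq, lie_vec]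
    exact map_zero φ
  rw [h0, hφ.apply_eq x, hφ.apply_eq y]
  ext
  · simp
  · simp [hφ.skew x.vec y.vec]

end HeisenbergAlgebra

/-- The underlying set `F φ ⊕ 𝔥` of the Heisenberg Lie algebra `𝔥 = V ⊕ F ħ` extended by `φ`;
the pair `(t, x)` stands for `t φ + x`. -/
@[ext] structure ExtendedHeisenberg {F V : Type*} [Field F] [AddCommGroup V] [Module F V]
    {ω : LinearMap.BilinForm F V} {hω : ω.IsAlt}
    {φ : HeisenbergAlgebra ω hω →ₗ[F] HeisenbergAlgebra ω hω}
    (hφ : HeisenbergAlgebra.IsExtending φ) where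
  coeff : F
  base : HeisenbergAlgebra ω hω

namespace ExtendedHeisenberg

variable {F V : Type*} [Field F] [AddCommGroup V] [Module F V]
  {ω : LinearMap.BilinForm F V} {hω : ω.IsAlt}
  {φ : HeisenbergAlgebra ω hω →ₗ[F] HeisenbergAlgebra ω hω}
  {hφ : HeisenbergAlgebra.IsExtending φ}

def toProd : ExtendedHeisenberg hφ ≃ F × HeisenbergAlgebra ω hω where
  toFun x := (x.coeff, x.base)
  invFun p := ⟨p.1, p.2⟩
  left_inv _ := rfl
  right_inv _ := rfl

instance : AddCommGroup (ExtendedHeisenberg hφ) := toProd.addCommGroup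

instance : Module F (ExtendedHeisenberg hφ) := toProd.module F

@[simp] lemma zero_coeff : (0 : ExtendedHeisenberg hφ).coeff = 0 := rfl
@[simp] lemma zero_base : (0 : ExtendedHeisenberg hφ).base = 0 := rfl
@[simp] lemma add_coeff (x y : ExtendedHeisenberg hφ) :
    (x + y).coeff = x.coeff + y.coeff := rfl
@[simp] lemma add_base (x y : ExtendedHeisenberg hφ) : (x + y).base = x.base + y.base := rfl
@[simp] lemma smul_coeff (t : F) (x : ExtendedHeisenberg hφ) :
    (t • x).coeff = t * x.coeff := rfl
@[simp] lemma smul_base (t : F) (x : ExtendedHeisenberg hφ) : (t • x).base = t • x.base := rfl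

/-- The bracket `[s φ + x, t φ + y] = s φ(y) - t φ(x) + [x, y]`. -/
instance : Bracket (ExtendedHeisenberg hφ) (ExtendedHeisenberg hφ) where
  bracket x y := ⟨0, x.coeff • φ y.base - y.coeff • φ x.base + ⁅x.base, y.base⁆⟩

@[simp] lemma lie_coeff (x y : ExtendedHeisenberg hφ) : ⁅x, y⁆.coeff = 0 := rfl
@[simp] lemma lie_base (x y : ExtendedHeisenberg hφ) :
    ⁅x, y⁆.base = x.coeff • φ y.base - y.coeff • φ x.base + ⁅x.base, y.base⁆ := rfl

instance : LieRing (ExtendedHeisenberg hφ) where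
  add_lie x y z := by
    refine ExtendedHeisenberg.ext (by simp) ?_
    simp only [lie_base, add_base, add_coeff, add_lie, map_add, add_smul, smul_add]
    abel
  lie_add x y z := by
    refine ExtendedHeisenberg.ext (by simp) ?_
    simp only [lie_base, add_base, add_coeff, lie_add, map_add, add_smul, smul_add]
    abel
  lie_self x := ExtendedHeisenberg.ext (by simp) (by simp)
  leibniz_lie x y z := by
    refine ExtendedHeisenberg.ext (by simp) ?_
    simp only [lie_base, add_base, lie_coeff, map_add, map_sub, map_smul, zero_smul, hφ.map_lie,
      smul_add, smul_sub, lie_add, lie_sub, add_lie, sub_lie, lie_smul, smul_lie, smul_smul,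
      leibniz_lie x.base y.base z.base]
    rw [mul_comm y.coeff x.coeff, mul_comm z.coeff x.coeff, mul_comm z.coeff y.coeff,
      ← lie_skew (φ x.base) y.base, smul_neg]
    abel

instance : LieAlgebra F (ExtendedHeisenberg hφ) where
  lie_smul t x y := by
    refine ExtendedHeisenberg.ext (by simp) ?_
    simp only [lie_base, smul_base, smul_coeff, map_smul, lie_smul, smul_add, smul_sub, smul_smul,
      mul_comm t]

end ExtendedHeisenberg

/-! Everything is read off from the linear form B(ħ, ·). The centre of the nilradical N is Fħ, so ħ
spans an ideal of g, and an invariant metric forces a one-dimensional ideal to be central.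
Invariance identifies [g, g]^⊥ with the centre of g, which lies in N and hence is Fħ; therefore ħ^⊥
⊆ [g, g]. Two facts of characteristic zero finish the structure. Rad ∩ [g, g] is nilpotent, so Rad ∩
ħ^⊥ ⊆ N, with equality because N ⊥ ħ. A form vanishing on [g, g] and on Rad is zero, since g/Rad is
semisimple, so B(ħ, d) = 1 for some d in Rad. Thus Rad = Fd ⊕ N. Subtracting an element of V from d
makes ad d preserve V. The identity B([d, v], w) = ω(v, w) then gives both the invertibility of φ
and, with B(ħ, d) = 1, the non-degeneracy of B on Rad. -/

section GeneralTheory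

/-! ### Solvable ideals and the radical in characteristic zero -/

open LieAlgebra LieModule TensorProduct

variable {F L M : Type*} [Field F] [LieRing L] [LieAlgebra F L]
  [AddCommGroup M] [Module F M] [LieRingModule L M] [LieModule F L M]

/-- An endomorphism that vanishes on an invariant subspace and is nilpotent on the quotient is
nilpotent. -/
lemma isNilpotent_toEnd_of_quotient (N : LieSubmodule F L M) {x : L}
    (hN : ∀ m ∈ N, ⁅x, m⁆ = 0) (hq : IsNilpotent (toEnd F L (M ⧸ N) x)) :
    IsNilpotent (toEnd F L M x) := by
  obtain ⟨n, hn⟩ := hq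
  refine ⟨n + 1, LinearMap.ext fun m ↦ ?_⟩
  have key : ∀ k : ℕ, LieSubmodule.Quotient.mk' N ((toEnd F L M x ^ k) m) =
      (toEnd F L (M ⧸ N) x ^ k) (LieSubmodule.Quotient.mk' N m) := by
    intro k
    induction k with
    | zero => simp
    | succ k ih =>
      rw [pow_succ', pow_succ', Module.End.mul_apply, Module.End.mul_apply, ← ih]
      exact LieModuleHom.map_lie (LieSubmodule.Quotient.mk' N) x _
  have hmem : (toEnd F L M x ^ n) m ∈ N := by
    rw [← LieSubmodule.Quotient.mk_eq_zero, key, hn, LinearMap.zero_apply]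
  rw [pow_succ', Module.End.mul_apply]
  exact hN _ hmem

/-- Over an algebraically closed field of characteristic zero, the elements of `⁅L, L⁆` that lie in
a solvable ideal act nilpotently on every finite-dimensional module. -/
lemma isNilpotent_toEnd_of_mem_solvable_of_isAlgClosed [IsAlgClosed F] [CharZero F]
    (I : LieIdeal F L) [IsSolvable I] {x : L} (hxI : x ∈ I) (hx : x ∈ derivedSeries F L 1)
    (M : Type*) [AddCommGroup M] [Module F M] [LieRingModule L M] [LieModule F L M]
    [FiniteDimensional F M] :
    IsNilpotent (toEnd F L M x) := by
  rcases subsingleton_or_nontrivial M with hM | hM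
  · exact ⟨1, LinearMap.ext fun m ↦ Subsingleton.elim _ _⟩
  obtain ⟨χ, hχ⟩ := exists_nontrivial_weightSpace_of_isSolvable F I M
  let W : LieSubmodule F L M := weightSpaceOfIsLieTower F M χ
  have hW : Nontrivial W := hχ
  have hact : ∀ m ∈ W, ⁅x, m⁆ = χ ⟨x, hxI⟩ • m := fun m hm ↦
    (mem_weightSpace χ m).mp hm ⟨x, hxI⟩
  -- A sum of commutators has trace zero on W, but x acts there as the scalar χ(x), so dim W · χ(x)
  -- = 0. Induction on the dimension then handles M/W.
  have htr : LinearMap.trace F W (toEnd F L W x) = 0 :=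
    trace_toEnd_eq_zero_of_mem_lcs F L W le_rfl (k := 1) (by simpa using hx)
  have hend : toEnd F L W x = χ ⟨x, hxI⟩ • LinearMap.id :=
    LinearMap.ext fun m ↦ Subtype.ext (hact m m.2)
  have hχ0 : χ ⟨x, hxI⟩ = 0 := by
    have hdim : (Module.finrank F W : F) ≠ 0 := Nat.cast_ne_zero.mpr Module.finrank_pos.ne'
    rw [hend, map_smul, LinearMap.trace_id, smul_eq_mul] at htr
    exact (mul_eq_zero.mp htr).resolve_right hdim
  have hlt : Module.finrank F (M ⧸ W) < Module.finrank F M := by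
    have h1 := W.toSubmodule.finrank_quotient_add_finrank
    have h2 : 0 < Module.finrank F W.toSubmodule := Module.finrank_pos (M := W)
    change Module.finrank F (M ⧸ W.toSubmodule) < _
    lia
  have : FiniteDimensional F (M ⧸ W) := inferInstanceAs (FiniteDimensional F (M ⧸ W.toSubmodule))
  exact isNilpotent_toEnd_of_quotient W (fun m hm ↦ by rw [hact m hm, hχ0, zero_smul])
    (isNilpotent_toEnd_of_mem_solvable_of_isAlgClosed I hxI hx (M ⧸ W))
termination_by Module.finrank F M
decreasing_by exact hlt

/-- Over a field of characteristic zero, the elements of `⁅L, L⁆` that lie in a solvable ideal act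
nilpotently on every finite-dimensional module. -/
theorem isNilpotent_toEnd_of_mem_solvable [CharZero F] [FiniteDimensional F M]
    (I : LieIdeal F L) [IsSolvable I] {x : L} (hxI : x ∈ I) (hx : x ∈ derivedSeries F L 1) :
    IsNilpotent (toEnd F L M x) := by
  -- Weights need an algebraically closed field; nilpotency descends because base change of
  -- endomorphisms is injective.
  let A := AlgebraicClosure F
  have hsolv : IsSolvable (LieSubmodule.baseChange A I) := by
    obtain ⟨k, hk⟩ := IsSolvable.solvable F I
    rw [LieIdeal.derivedSeries_eq_bot_iff] at hk
    refine IsSolvable.mk (R := A) (k := k) ?_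
    rw [LieIdeal.derivedSeries_eq_bot_iff, derivedSeriesOfIdeal_baseChange, hk,
      LieSubmodule.baseChange_bot]
  have hxI' : (1 : A) ⊗ₜ[F] x ∈ LieSubmodule.baseChange A I :=
    Submodule.tmul_mem_baseChange_of_mem 1 hxI
  have hx' : (1 : A) ⊗ₜ[F] x ∈ derivedSeries A (A ⊗[F] L) 1 := by
    rw [derivedSeries_baseChange]
    exact Submodule.tmul_mem_baseChange_of_mem 1 hx
  have hinj : Function.Injective (Module.End.baseChangeHom F A M) :=
    LinearMap.baseChangeHom_injective F M A
  rw [← IsNilpotent.map_iff hinj]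
  change IsNilpotent ((toEnd F L M x).baseChange A)
  rw [← toEnd_baseChange]
  exact isNilpotent_toEnd_of_mem_solvable_of_isAlgClosed _ hxI' hx' (A ⊗[F] M)

/-- The intersection of the solvable radical with the derived ideal is nilpotent. -/
theorem isNilpotent_radical_inf_derivedSeries [CharZero F] [FiniteDimensional F L] :
    LieRing.IsNilpotent ↥(radical F L ⊓ derivedSeries F L 1) := by
  -- Engel's theorem reduces the claim to ad-nilpotency of each element.
  rw [LieAlgebra.isNilpotent_iff_forall (R := F)]
  rintro ⟨x, hx⟩
  apply LieSubalgebra.isNilpotent_ad_of_isNilpotent_ad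
    ((radical F L ⊓ derivedSeries F L 1 : LieIdeal F L) : LieSubalgebra F L) (x := ⟨x, hx⟩)
  rw [LieSubmodule.mem_inf] at hx
  exact isNilpotent_toEnd_of_mem_solvable (M := L) (radical F L) hx.1 hx.2

/-- The preimage of a solvable ideal is an extension of solvable by solvable, so it already lies in
the radical. -/
instance hasTrivialRadical_quotient_radical [FiniteDimensional F L] :
    HasTrivialRadical F (L ⧸ radical F L) := by
  refine hasTrivialRadical_of_no_solvable_ideals fun J hJ ↦ ?_
  let π : L →ₗ⁅F⁆ L ⧸ radical F L :=
    { toLinearMap := (radical F L).toSubmodule.mkQ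
      map_lie' := fun {x y} ↦ LieSubmodule.Quotient.mk_bracket (I := radical F L) x y }
  have hπ : ∀ x, π x = 0 ↔ x ∈ radical F L := fun x ↦ LieSubmodule.Quotient.mk_eq_zero'
  have hsurj : Function.Surjective π := Submodule.mkQ_surjective _
  obtain ⟨k, hk⟩ := IsSolvable.solvable F J
  obtain ⟨l, hl⟩ := IsSolvable.solvable F (radical F L)
  rw [LieIdeal.derivedSeries_eq_bot_iff] at hk hl
  have hmap : ∀ n, ∀ x ∈ derivedSeriesOfIdeal F L n (J.comap π),
      π x ∈ derivedSeriesOfIdeal F _ n J := by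
    intro n
    suffices derivedSeriesOfIdeal F L n (J.comap π) ≤ (derivedSeriesOfIdeal F _ n J).comap π from
      fun x hx ↦ this hx
    induction n with
    | zero => simp
    | succ n ih =>
      rw [derivedSeriesOfIdeal_succ, derivedSeriesOfIdeal_succ, LieSubmodule.lieIdeal_oper_eq_span,
        LieSubmodule.lieSpan_le]
      rintro - ⟨⟨x, hx⟩, ⟨y, hy⟩, rfl⟩
      simp only [LieIdeal.mem_comap, SetLike.mem_coe, LieHom.map_lie]
      exact LieSubmodule.lie_mem_lie (ih hx) (ih hy)
  have hle : derivedSeriesOfIdeal F L k (J.comap π) ≤ radical F L := by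
    intro x hx
    have := hmap k x hx
    rwa [hk, LieSubmodule.mem_bot, hπ] at this
  have hsolv : IsSolvable (J.comap π) := by
    refine IsSolvable.mk (R := F) (k := l + k) ?_
    rw [LieIdeal.derivedSeries_eq_bot_iff, derivedSeriesOfIdeal_add, eq_bot_iff, ← hl]
    exact derivedSeriesOfIdeal_mono hle l
  rw [LieSubmodule.eq_bot_iff]
  intro y hy
  obtain ⟨x, rfl⟩ := hsurj y
  exact (hπ x).mpr ((LieIdeal.solvable_iff_le_radical F L _).mp hsolv hy)

/-- On a Killing Lie algebra a linear form that vanishes on brackets is zero. -/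
lemma eq_zero_of_apply_lie_eq_zero [IsKilling F L] [FiniteDimensional F L]
    (f : Module.Dual F L) (hf : ∀ x y : L, f ⁅x, y⁆ = 0) : f = 0 := by
  -- The vector representing f under the Killing form is central by invariance, and the centre is
  -- trivial.
  have hκ : LinearMap.BilinForm.Nondegenerate (killingForm F L) :=
    IsKilling.killingForm_nondegenerate F L
  set t := (LinearMap.BilinForm.toDual (killingForm F L) hκ).symm f with ht
  have htf : ∀ z, killingForm F L t z = f z := fun z ↦
    LinearMap.BilinForm.apply_toDual_symm_apply (hB := hκ) f z
  have hcen : t ∈ center F L := by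
    rw [LieModule.mem_maxTrivSubmodule]
    intro x
    rw [← lie_skew, neg_eq_zero]
    refine hκ.1 _ fun y ↦ ?_
    rw [traceForm_apply_lie_apply, htf, hf]
  rw [center_eq_bot, LieSubmodule.mem_bot] at hcen
  ext z
  rw [← htf, hcen, map_zero]

/-- In characteristic zero a linear form that vanishes on brackets and on the solvable radical is
zero. -/
theorem eq_zero_of_apply_lie_eq_zero_of_apply_radical_eq_zero [CharZero F] [FiniteDimensional F L]
    (f : Module.Dual F L) (hf : ∀ x y : L, f ⁅x, y⁆ = 0) (hR : ∀ x ∈ radical F L, f x = 0) :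
    f = 0 := by
  have : FiniteDimensional F (L ⧸ radical F L) :=
    inferInstanceAs (FiniteDimensional F (L ⧸ (radical F L).toSubmodule))
  let f' : Module.Dual F (L ⧸ radical F L) := (radical F L).toSubmodule.liftQ f hR
  have h0 : f' = 0 := by
    refine eq_zero_of_apply_lie_eq_zero f' fun x y ↦ ?_
    obtain ⟨x, rfl⟩ := LieSubmodule.Quotient.surjective_mk' (radical F L) x
    obtain ⟨y, rfl⟩ := LieSubmodule.Quotient.surjective_mk' (radical F L) y
    exact hf x y
  ext x
  exact LinearMap.congr_fun h0 (LieSubmodule.Quotient.mk x)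

end GeneralTheory

/-! ### Coordinates on an ideal isomorphic to the Heisenberg algebra -/

section HeisenbergNilradical

open LieAlgebra

variable {F g V : Type*} [Field F] [LieRing g] [LieAlgebra F g] [AddCommGroup V] [Module F V]
  {ω : LinearMap.BilinForm F V} {hω : ω.IsAlt} {B : LinearMap.BilinForm F g}

lemma LieIdeal.le_nilpotentRadical (I : LieIdeal F g) (hI : LieRing.IsNilpotent I) :
    I ≤ nilpotentRadical F g :=
  le_sSup hI

lemma nilpotentRadical_le_radical [FiniteDimensional F g] :
    nilpotentRadical F g ≤ radical F g := by
  refine sSup_le fun I hI ↦ ?_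
  have : LieRing.IsNilpotent I := hI
  exact (LieIdeal.solvable_iff_le_radical F g I).mp inferInstance

/-- The inclusion of `V` into a Lie algebra one of whose ideals is identified with `V ⊕ F ħ`. -/
def heisenbergVec {N : LieIdeal F g} (e : N ≃ₗ⁅F⁆ HeisenbergAlgebra ω hω) : V →ₗ[F] g where
  toFun v := e.symm (HeisenbergAlgebra.ofVec ω hω v)
  map_add' u v := by
    rw [show HeisenbergAlgebra.ofVec ω hω (u + v) =
      HeisenbergAlgebra.ofVec ω hω u + HeisenbergAlgebra.ofVec ω hω v by
        ext <;> simp [HeisenbergAlgebra.ofVec], map_add]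
    rfl
  map_smul' t v := by
    rw [show HeisenbergAlgebra.ofVec ω hω (t • v) = t • HeisenbergAlgebra.ofVec ω hω v by
        ext <;> simp [HeisenbergAlgebra.ofVec], map_smul]
    rfl

/-- The element `ħ` of a Lie algebra one of whose ideals is identified with `V ⊕ F ħ`. -/
def heisenbergHbar {N : LieIdeal F g} (e : N ≃ₗ⁅F⁆ HeisenbergAlgebra ω hω) : g :=
  e.symm (HeisenbergAlgebra.hbar ω hω)

section Ideal

variable {N : LieIdeal F g} (e : N ≃ₗ⁅F⁆ HeisenbergAlgebra ω hω)

local notation "ι" => heisenbergVec e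
local notation "ħ" => heisenbergHbar e

lemma heisenbergVec_mem (v : V) : ι v ∈ N := (e.symm _).2

lemma heisenbergHbar_mem : ħ ∈ N := (e.symm _).2

lemma coe_symm_eq_heisenbergVec_add (x : HeisenbergAlgebra ω hω) :
    (e.symm x : g) = ι x.vec + x.coeff • ħ := by
  conv_lhs => rw [HeisenbergAlgebra.eq_ofVec_add_smul_hbar x, map_add, map_smul]
  rfl

lemma eq_heisenbergVec_add {x : g} (hx : x ∈ N) :
    x = ι (e ⟨x, hx⟩).vec + (e ⟨x, hx⟩).coeff • ħ := by
  rw [← coe_symm_eq_heisenbergVec_add, LieEquiv.symm_apply_apply]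

lemma heisenbergVec_add_smul_eq_zero {v : V} {c : F} (h : ι v + c • ħ = 0) : v = 0 ∧ c = 0 := by
  have h1 : e.symm (⟨v, c⟩ : HeisenbergAlgebra ω hω) = 0 :=
    Subtype.ext ((coe_symm_eq_heisenbergVec_add e _).trans h)
  have h2 : (⟨v, c⟩ : HeisenbergAlgebra ω hω) = 0 := by
    rw [← LieEquiv.apply_symm_apply e ⟨v, c⟩, h1, map_zero]
  exact ⟨congrArg HeisenbergAlgebra.vec h2, congrArg HeisenbergAlgebra.coeff h2⟩

lemma lie_coe_symm (x y : HeisenbergAlgebra ω hω) :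
    ⁅(e.symm x : g), (e.symm y : g)⁆ = ω x.vec y.vec • ħ := by
  have h := coe_symm_eq_heisenbergVec_add e ⁅x, y⁆
  rw [LieEquiv.map_lie, HeisenbergAlgebra.lie_vec, HeisenbergAlgebra.lie_coeff, map_zero,
    zero_add] at h
  exact h

lemma lie_heisenbergVec (u v : V) : ⁅ι u, ι v⁆ = ω u v • ħ := lie_coe_symm e _ _

lemma lie_heisenbergHbar_of_mem {x : g} (hx : x ∈ N) : ⁅x, ħ⁆ = 0 := by
  have h := lie_coe_symm e (e ⟨x, hx⟩) (HeisenbergAlgebra.hbar ω hω)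
  rw [LieEquiv.symm_apply_apply] at h
  exact h.trans (by simp [HeisenbergAlgebra.hbar])

lemma heisenbergHbar_ne_zero : ħ ≠ 0 := fun h ↦
  one_ne_zero (heisenbergVec_add_smul_eq_zero e (v := 0) (c := 1) (by simp [h])).2

/-- The elements of `N` that commute with `N` are the multiples of `ħ`. -/
lemma exists_eq_smul_heisenbergHbar (hω_nondeg : ω.Nondegenerate) {x : g} (hx : x ∈ N)
    (hc : ∀ y ∈ N, ⁅x, y⁆ = 0) : ∃ c : F, x = c • ħ := by
  refine ⟨(e ⟨x, hx⟩).coeff, ?_⟩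
  have hx' := eq_heisenbergVec_add e hx
  have hv : (e ⟨x, hx⟩).vec = 0 := by
    refine hω_nondeg.1 _ fun w ↦ ?_
    have h := hc _ (heisenbergVec_mem e w)
    rw [hx', add_lie, smul_lie, lie_heisenbergVec, ← lie_skew,
      lie_heisenbergHbar_of_mem e (heisenbergVec_mem e w), neg_zero, smul_zero, add_zero] at h
    exact (smul_eq_zero.mp h).resolve_right (heisenbergHbar_ne_zero e)
  rwa [hv, map_zero, zero_add] at hx'

end Ideal

lemma exists_eq_smul_heisenbergHbar_of_mem_center (hω_nondeg : ω.Nondegenerate)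
    (e : nilpotentRadical F g ≃ₗ⁅F⁆ HeisenbergAlgebra ω hω) {z : g} (hz : ∀ x : g, ⁅x, z⁆ = 0) :
    ∃ c : F, z = c • heisenbergHbar e := by
  have hz' : z ∈ center F g := (LieModule.mem_maxTrivSubmodule F g g z).mpr hz
  have hle : center F g ≤ nilpotentRadical F g :=
    LieIdeal.le_nilpotentRadical _ (by
      have : IsLieAbelian (center F g) := inferInstance
      infer_instance)
  refine exists_eq_smul_heisenbergHbar e hω_nondeg (hle hz') fun y _ ↦ ?_
  rw [← lie_skew, hz, neg_zero]

/-- The endomorphism `φ ⊕ 0` of `V ⊕ F ħ`. -/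
def HeisenbergAlgebra.extend (hω : ω.IsAlt) (φ : V →ₗ[F] V) :
    HeisenbergAlgebra ω hω →ₗ[F] HeisenbergAlgebra ω hω where
  toFun x := HeisenbergAlgebra.ofVec ω hω (φ x.vec)
  map_add' x y := by ext <;> simp [HeisenbergAlgebra.ofVec]
  map_smul' t x := by ext <;> simp [HeisenbergAlgebra.ofVec]

lemma HeisenbergAlgebra.isExtending_extend {φ : V →ₗ[F] V} (hbij : Function.Bijective φ)
    (hskew : ∀ u v, ω (φ u) v = -ω u (φ v)) :
    HeisenbergAlgebra.IsExtending (HeisenbergAlgebra.extend hω φ) where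
  map_hbar := by ext <;> simp [HeisenbergAlgebra.extend, HeisenbergAlgebra.ofVec,
    HeisenbergAlgebra.hbar]
  map_vec _ := rfl
  bijective := hbij
  skew := hskew

/-! ### Consequences of the invariant metric -/

section Metric

variable {N : LieIdeal F g} (e : N ≃ₗ⁅F⁆ HeisenbergAlgebra ω hω)

local notation "ι" => heisenbergVec e
local notation "ħ" => heisenbergHbar e

lemma IsInvariantMetric.exists_apply_ne_zero (hB : IsInvariantMetric B) {x : g} (hx : x ≠ 0) :
    ∃ y, B x y ≠ 0 := by
  by_contra! h
  exact hx (hB.nondegenerate.1 x h)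

/-- An element spanning a one-dimensional ideal of a quadratic Lie algebra is central. -/
lemma IsInvariantMetric.lie_eq_zero_of_forall_lie_eq_smul [CharZero F]
    (hB : IsInvariantMetric B) {z : g} (hz : ∀ x : g, ∃ c : F, ⁅x, z⁆ = c • z) (x : g) :
    ⁅x, z⁆ = 0 := by
  rcases eq_or_ne z 0 with rfl | hz0
  · simp
  choose c hc using hz
  -- Invariance makes c(x)B(z, y) antisymmetric in x and y. Taking x = y with B(z, y) ≠ 0 gives c(y)
  -- = 0, and then c = 0.
  have key : ∀ x y : g, c x * B z y = -(c y * B z x) := fun x y ↦ by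
    have h := hB.invariant x z y
    rw [hc x, ← lie_skew, hc y] at h
    simpa [hB.symm x z] using h.symm
  obtain ⟨y, hy⟩ := hB.exists_apply_ne_zero hz0
  have hcy : c y = 0 := by
    have h := key y y
    rw [eq_neg_iff_add_eq_zero, ← two_mul] at h
    simpa [hy] using h
  have h := key x y
  rw [hcy, zero_mul, neg_zero] at h
  rw [hc x, (mul_eq_zero.mp h).resolve_right hy, zero_smul]

lemma exists_apply_eq_one (hω_nondeg : ω.Nondegenerate) {u : V} (hu : u ≠ 0) : ∃ w, ω u w = 1 := by
  obtain ⟨w, hw⟩ : ∃ w, ω u w ≠ 0 := by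
    by_contra! h
    exact hu (hω_nondeg.1 u h)
  exact ⟨(ω u w)⁻¹ • w, by simp [hw]⟩

/-- Invariance moves d out of the bracket: B(d, [v, w]) = ω(v, w) B(d, ħ). This links B to ω. -/
lemma apply_lie_heisenbergVec (hB : IsInvariantMetric B) {d : g} (hd : B ħ d = 1) (v w : V) :
    B ⁅d, ι v⁆ (ι w) = ω v w := by
  rw [← hB.invariant, lie_heisenbergVec, map_smul, hB.symm, hd, smul_eq_mul, mul_one]

lemma bijective_of_lie_eq (hω_nondeg : ω.Nondegenerate) (hB : IsInvariantMetric B)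
    [FiniteDimensional F V] {d : g} (hd : B ħ d = 1) {φ : V →ₗ[F] V} (hφ : ∀ v, ⁅d, ι v⁆ = ι (φ v)) :
    Function.Bijective φ := by
  have hinj : Function.Injective φ := by
    rw [injective_iff_map_eq_zero]
    intro v hv
    refine hω_nondeg.1 v fun w ↦ ?_
    rw [← apply_lie_heisenbergVec e hB hd, hφ, hv, map_zero, map_zero, LinearMap.zero_apply]
  exact ⟨hinj, LinearMap.injective_iff_surjective.mp hinj⟩

variable [CharZero F] (hω_nondeg : ω.Nondegenerate) (hB : IsInvariantMetric B)

include hω_nondeg hB in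
-- The centre of an ideal is again an ideal, and that of N is the line Fħ.
lemma lie_heisenbergHbar (x : g) : ⁅x, ħ⁆ = 0 := by
  refine hB.lie_eq_zero_of_forall_lie_eq_smul (fun x ↦ ?_) x
  refine exists_eq_smul_heisenbergHbar e hω_nondeg (N.lie_mem (heisenbergHbar_mem e)) fun y hy ↦ ?_
  rw [lie_lie, ← lie_skew _ y, lie_heisenbergHbar_of_mem e hy, neg_zero, lie_zero, zero_sub,
    ← lie_skew, neg_neg, lie_heisenbergHbar_of_mem e (N.lie_mem hy)]

include hω_nondeg hB in
lemma apply_heisenbergHbar_lie (x y : g) : B ħ ⁅x, y⁆ = 0 := by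
  rw [hB.invariant, ← lie_skew, lie_heisenbergHbar e hω_nondeg hB, neg_zero, map_zero,
    LinearMap.zero_apply]

include hω_nondeg hB in
lemma apply_heisenbergHbar_of_mem [Nontrivial V] {x : g} (hx : x ∈ N) : B ħ x = 0 := by
  have hvec : ∀ u : V, B ħ (ι u) = 0 := fun u ↦ by
    rcases eq_or_ne u 0 with rfl | hu
    · simp
    obtain ⟨w, hw⟩ := exists_apply_eq_one hω_nondeg hu
    have h := lie_heisenbergVec e u w
    rw [hw, one_smul, ← lie_skew] at h
    -- With ħ = [u, w], B(ħ, u) = -B(w, [u, u]) = 0.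
    rw [← h, map_neg, LinearMap.neg_apply, ← hB.invariant, lie_self, map_zero, neg_zero]
  have hhbar : B ħ ħ = 0 := by
    obtain ⟨u, hu⟩ := exists_ne (0 : V)
    obtain ⟨w, hw⟩ := exists_apply_eq_one hω_nondeg hu
    have h := apply_heisenbergHbar_lie e hω_nondeg hB (ι u) (ι w)
    rwa [lie_heisenbergVec, hw, one_smul] at h
  rw [eq_heisenbergVec_add e hx, map_add, map_smul, hvec, hhbar, smul_zero, add_zero]

include hω_nondeg hB in
-- Apply the derivation ad d to [u, v] = ω(u, v)ħ and use that ħ is central.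
lemma skew_of_lie_eq {d : g} {φ : V →ₗ[F] V} (hφ : ∀ v, ⁅d, ι v⁆ = ι (φ v)) (u v : V) :
    ω (φ u) v = -ω u (φ v) := by
  have h := leibniz_lie d (ι u) (ι v)
  rw [hφ, hφ, lie_heisenbergVec, lie_heisenbergVec, lie_heisenbergVec, lie_smul,
    lie_heisenbergHbar e hω_nondeg hB, smul_zero, ← add_smul] at h
  exact eq_neg_of_add_eq_zero_left
    ((smul_eq_zero.mp h.symm).resolve_right (heisenbergHbar_ne_zero e))

end Metric

/-! ### The radical as a one-dimensional extension of the nilradical -/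

section Nilradical

variable [FiniteDimensional F g]
  (hω_nondeg : ω.Nondegenerate) (hB : IsInvariantMetric B)
  (e : nilpotentRadical F g ≃ₗ⁅F⁆ HeisenbergAlgebra ω hω)

local notation "ι" => heisenbergVec e
local notation "ħ" => heisenbergHbar e

include hω_nondeg hB in
/-- The hyperplane orthogonal to `ħ` is contained in the derived ideal. -/
lemma mem_derivedSeries_of_apply_heisenbergHbar_eq_zero {x : g} (hx : B ħ x = 0) :
    x ∈ derivedSeries F g 1 := by
  have hrefl : B.IsRefl := fun a b h ↦ (hB.symm b a).trans h
  -- By double orthogonality it suffices that every z ⊥ [g, g] is a multiple of ħ; such z is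
  -- central.
  rw [← LieSubmodule.mem_toSubmodule,
    ← LinearMap.BilinForm.orthogonal_orthogonal hB.nondegenerate hrefl
      (derivedSeries F g 1).toSubmodule, LinearMap.BilinForm.mem_orthogonal_iff]
  intro z hz
  rw [LinearMap.BilinForm.mem_orthogonal_iff] at hz
  obtain ⟨c, rfl⟩ := exists_eq_smul_heisenbergHbar_of_mem_center hω_nondeg e (z := z) fun a ↦ by
    refine hB.nondegenerate.2 _ fun b ↦ ?_
    rw [hB.invariant]
    exact hz _ (LieSubmodule.lie_mem_lie (LieSubmodule.mem_top b) (LieSubmodule.mem_top a))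
  change B (c • ħ) x = 0
  rw [map_smul, LinearMap.smul_apply, hx, smul_zero]

variable [CharZero F]

include hω_nondeg hB in
lemma exists_mem_radical_apply_heisenbergHbar_eq_one : ∃ d ∈ radical F g, B ħ d = 1 := by
  obtain ⟨d, hd, hd0⟩ : ∃ d ∈ radical F g, B ħ d ≠ 0 := by
    by_contra! h
    have h0 := eq_zero_of_apply_lie_eq_zero_of_apply_radical_eq_zero (B ħ)
      (apply_heisenbergHbar_lie e hω_nondeg hB) h
    exact heisenbergHbar_ne_zero e (hB.nondegenerate.1 _ fun y ↦ by rw [h0, LinearMap.zero_apply])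
  exact ⟨(B ħ d)⁻¹ • d, SMulMemClass.smul_mem _ hd, by simp [hd0]⟩

include hω_nondeg hB in
lemma mem_nilpotentRadical_of_apply_heisenbergHbar_eq_zero {x : g} (hxR : x ∈ radical F g)
    (hx : B ħ x = 0) : x ∈ nilpotentRadical F g :=
  LieIdeal.le_nilpotentRadical _ isNilpotent_radical_inf_derivedSeries
    ((LieSubmodule.mem_inf _ _ _).mpr
      ⟨hxR, mem_derivedSeries_of_apply_heisenbergHbar_eq_zero hω_nondeg hB e hx⟩)

include hω_nondeg hB in
/-- There is a transversal `d` to the nilradical in the solvable radical that preserves `V`. -/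
lemma exists_transversal [Nontrivial V] [FiniteDimensional F V] :
    ∃ d ∈ radical F g, B ħ d = 1 ∧ ∃ φ : V →ₗ[F] V, ∀ v, ⁅d, ι v⁆ = ι (φ v) := by
  obtain ⟨d, hd, hd1⟩ := exists_mem_radical_apply_heisenbergHbar_eq_one hω_nondeg hB e
  have hmem : ∀ v, ⁅d, ι v⁆ ∈ nilpotentRadical F g := fun v ↦
    LieSubmodule.lie_mem _ (heisenbergVec_mem e v)
  let p : V →ₗ[F] nilpotentRadical F g :=
    (LieAlgebra.ad F g d ∘ₗ ι).codRestrict (nilpotentRadical F g).toSubmodule hmem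
  let φ : V →ₗ[F] V :=
    { toFun := fun v ↦ (e (p v)).vec
      map_add' := fun u v ↦ by simp
      map_smul' := fun t v ↦ by simp }
  let f : V →ₗ[F] F :=
    { toFun := fun v ↦ (e (p v)).coeff
      map_add' := fun u v ↦ by simp
      map_smul' := fun t v ↦ by simp }
  have hdv : ∀ v, ⁅d, ι v⁆ = ι (φ v) + f v • ħ := fun v ↦ eq_heisenbergVec_add e (hmem v)
  -- Choosing ω(n, ·) = f makes ad n cancel the ħ-component of ad d on V; B(ħ, d) is unchanged since
  -- ħ ⊥ N.
  set n := (LinearMap.BilinForm.toDual ω hω_nondeg).symm f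
  have hn : ∀ v, ω n v = f v := fun v ↦
    LinearMap.BilinForm.apply_toDual_symm_apply (hB := hω_nondeg) f v
  refine ⟨d - ι n, sub_mem hd (nilpotentRadical_le_radical (heisenbergVec_mem e n)), ?_, φ, ?_⟩
  · rw [map_sub, hd1, apply_heisenbergHbar_of_mem e hω_nondeg hB (heisenbergVec_mem e n), sub_zero]
  · intro v
    rw [sub_lie, hdv, lie_heisenbergVec, hn, add_sub_cancel_right]

include hω_nondeg hB in
/-- The solvable radical is the Heisenberg Lie algebra extended by the action of a transversal. -/
lemma nonempty_radical_equiv_extendedHeisenberg [Nontrivial V] {d : g} (hdR : d ∈ radical F g)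
    (hd : B ħ d = 1) {φ : V →ₗ[F] V} (hφ : ∀ v, ⁅d, ι v⁆ = ι (φ v))
    (hext : HeisenbergAlgebra.IsExtending (HeisenbergAlgebra.extend hω φ)) :
    Nonempty (radical F g ≃ₗ⁅F⁆ ExtendedHeisenberg hext) := by
  have hN : ∀ {x}, x ∈ nilpotentRadical F g → B ħ x = 0 :=
    apply_heisenbergHbar_of_mem e hω_nondeg hB
  have hlie : ∀ x : HeisenbergAlgebra ω hω,
      ⁅d, (e.symm x : g)⁆ = e.symm (HeisenbergAlgebra.extend hω φ x) := fun x ↦ by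
    rw [coe_symm_eq_heisenbergVec_add, lie_add, lie_smul, lie_heisenbergHbar e hω_nondeg hB,
      smul_zero, add_zero, hφ]
    rfl
  let ψ : ExtendedHeisenberg hext →ₗ⁅F⁆ radical F g :=
    { toFun := fun x ↦ ⟨x.coeff • d + e.symm x.base,
        add_mem (SMulMemClass.smul_mem _ hdR) (nilpotentRadical_le_radical (e.symm x.base).2)⟩
      map_add' := fun x y ↦ Subtype.ext <| by
        simp only [ExtendedHeisenberg.add_coeff, ExtendedHeisenberg.add_base, map_add, add_smul,
          LieSubmodule.coe_add]
        abel
      map_smul' := fun t x ↦ Subtype.ext <| by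
        simp [mul_smul]
      map_lie' := fun {x y} ↦ Subtype.ext <| by
        have hcoe : ∀ a b : nilpotentRadical F g, ((⁅a, b⁆ : nilpotentRadical F g) : g) =
            ⁅(a : g), (b : g)⁆ := fun _ _ ↦ rfl
        change (0 : F) • d + ((e.symm ⁅x, y⁆.base : nilpotentRadical F g) : g) =
          ⁅x.coeff • d + (e.symm x.base : g), y.coeff • d + (e.symm y.base : g)⁆
        simp only [ExtendedHeisenberg.lie_base, map_add, map_sub, map_smul, zero_smul, zero_add,
          LieSubmodule.coe_add, LieSubmodule.coe_sub, LieSubmodule.coe_smul, LieEquiv.map_lie,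
          hcoe, add_lie, lie_add, smul_lie, lie_smul, lie_self, smul_zero, hlie]
        rw [← lie_skew _ d, hlie, smul_neg]
        abel }
  have hψ : ∀ x, (ψ x : g) = x.coeff • d + e.symm x.base := fun _ ↦ rfl
  have hbij : Function.Bijective ψ := by
    constructor
    · rw [injective_iff_map_eq_zero]
      intro x hx
      have h0 : x.coeff • d + (e.symm x.base : g) = 0 := (hψ x).symm.trans (congrArg _ hx)
      have hc : x.coeff = 0 := by
        have h := congrArg (B ħ) h0
        simpa [hd, hN (e.symm x.base).2] using h
      rw [hc, zero_smul, zero_add, ZeroMemClass.coe_eq_zero, EmbeddingLike.map_eq_zero_iff] at h0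
      exact ExtendedHeisenberg.ext hc h0
    · rintro ⟨x, hx⟩
      -- B(ħ, ·) reads off the d-coordinate; the remainder is orthogonal to ħ.
      have hmem : x - B ħ x • d ∈ nilpotentRadical F g :=
        mem_nilpotentRadical_of_apply_heisenbergHbar_eq_zero hω_nondeg hB e
          (sub_mem hx (SMulMemClass.smul_mem _ hdR)) (by simp [hd])
      exact ⟨⟨B ħ x, e ⟨_, hmem⟩⟩, Subtype.ext (by simp [hψ])⟩
  exact ⟨(LieEquiv.ofBijective ψ hbij).symm⟩

include hω_nondeg hB in
lemma restrict_radical_nondegenerate [Nontrivial V] {d : g} (hdR : d ∈ radical F g)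
    (hd : B ħ d = 1) : (B.restrict (radical F g).toSubmodule).Nondegenerate := by
  have hNR := nilpotentRadical_le_radical (F := F) (g := g)
  have hleft : ∀ x ∈ radical F g, (∀ y ∈ radical F g, B x y = 0) → x = 0 := by
    intro x hx h
    have hmem := mem_nilpotentRadical_of_apply_heisenbergHbar_eq_zero hω_nondeg hB e hx
      ((hB.symm _ _).trans (h _ (hNR (heisenbergHbar_mem e))))
    have hx' := eq_heisenbergVec_add e hmem
    -- Orthogonality to ħ has put x in N. Now ω(v, w) = B([d, x], w) = -B(x, [d, w]) = 0 kills its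
    -- V-part v; pairing with d will kill the ħ-part.
    have hv : (e ⟨x, hmem⟩).vec = 0 := by
      refine hω_nondeg.1 _ fun w ↦ ?_
      have h1 : ⁅d, x⁆ = ⁅d, ι (e ⟨x, hmem⟩).vec⁆ := by
        conv_lhs => rw [hx', lie_add, lie_smul, lie_heisenbergHbar e hω_nondeg hB, smul_zero,
          add_zero]
      rw [← apply_lie_heisenbergVec e hB hd, ← h1, ← lie_skew, map_neg, LinearMap.neg_apply,
        ← hB.invariant, h _ (LieSubmodule.lie_mem _ (hNR (heisenbergVec_mem e w))), neg_zero]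
    rw [hv, map_zero, zero_add] at hx'
    have hc := h d hdR
    rw [hx', map_smul, LinearMap.smul_apply, hd, smul_eq_mul, mul_one] at hc
    rw [hx', hc, zero_smul]
  refine ⟨fun x hx ↦ Subtype.ext (hleft x x.2 fun y hy ↦ hx ⟨y, hy⟩),
    fun x hx ↦ Subtype.ext (hleft x x.2 fun y hy ↦ ?_)⟩
  rw [hB.symm]
  exact hx ⟨y, hy⟩

end Nilradical

end HeisenbergNilradical

theorem mainTheorem4 {F g V : Type*} [Field F] [CharZero F]
    [LieRing g] [LieAlgebra F g] [FiniteDimensional F g]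
    [AddCommGroup V] [Module F V] (m : ℕ) (hm : 1 ≤ m) (hV : Module.finrank F V = 2 * m)
    (ω : LinearMap.BilinForm F V) (hω : ω.IsAlt) (hω_nondeg : ω.Nondegenerate)
    (B : LinearMap.BilinForm F g) (hB : IsInvariantMetric B)
    (hNil : Nonempty (nilpotentRadical F g ≃ₗ⁅F⁆ HeisenbergAlgebra ω hω)) :
    (∃ (φ : HeisenbergAlgebra ω hω →ₗ[F] HeisenbergAlgebra ω hω)
        (hφ : HeisenbergAlgebra.IsExtending φ),
        Nonempty (LieAlgebra.radical F g ≃ₗ⁅F⁆ ExtendedHeisenberg hφ)) ∧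
      (B.restrict (LieAlgebra.radical F g).toSubmodule).Nondegenerate := by
  obtain ⟨e⟩ := hNil
  have hpos : 0 < Module.finrank F V := by lia
  have : Nontrivial V := Module.nontrivial_of_finrank_pos hpos
  have : FiniteDimensional F V := Module.finite_of_finrank_pos hpos
  obtain ⟨d, hdR, hd, φ, hφ⟩ := exists_transversal hω_nondeg hB e
  have hext := HeisenbergAlgebra.isExtending_extend (hω := hω)
    (bijective_of_lie_eq e hω_nondeg hB hd hφ) (skew_of_lie_eq e hω_nondeg hB hφ)
  exact ⟨⟨_, hext, nonempty_radical_equiv_extendedHeisenberg hω_nondeg hB e hdR hd hφ hext⟩,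
    restrict_radical_nondegenerate hω_nondeg hB e hdR hd⟩
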